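/- **Model.** Let $X,Y$ be finite sets and $f:X\times Y\to\{0,1\}$. In the *server model* Carol receives $x\in X$, David receives $y\in Y$, and a server receives no input. The three parties hold finite-dimensional quantum registers which initially are in an arbitrary entangled pure state independent of the input. The computation proceeds in synchronous rounds. In each round every party applies a local isometry (a unitary that may use fresh ancillas) to everything it holds, where Carol's operation may depend on $x$ and David's on $y$, and then sends messages: Carol sends at most one qubit, either to the server or to David; David sends at most one qubit, either to the server or to Carol (the recipients are fixed by the protocol); the server sends quantum messages of arbitrary finite dimension to Carol and to David for free. At the end Carol and David each obtain an output bit by a two-outcome projective measurement of what they hold, which may depend on their own input. The protocol computes $f$ with $(\epsilon_0,\epsilon_1)$-error if, for every $(x,y)$, Carol outputs $f(x,y)$ with probability at least $1-\epsilon_{f(x,y)}$, and so does David. Let $Q=Q^{*,sv}_{\epsilon_0,\epsilon_1}(f)$ be the least number of rounds of a protocol that computes $f$ with $(\epsilon_0,\epsilon_1)$-error. An *entangled strategy* for two players, Alice and Bob, consists of a unit vector $|\psi\rangle\in\mathbb C^d\otimes\mathbb C^d$ for some $d\ge 1$ and projective measurements $\{A_x^0,A_x^1\}$ $(x\in X)$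 and $\{B_y^0,B_y^1\}$ $(y\in Y)$ on $\mathbb C^d$; on input $(x,y)$ the players answer $(a,b)\in\{0,1\}^2$ with probability $\langle\psi|A_x^a\otimes B_y^b|\psi\rangle$. Used as an XOR-game strategy it outputs $a\oplus b$; used as an AND-game strategy it outputs $a\wedge b$. **Lemma.** Let $X,Y$ be finite sets, $f:X\times Y\to\{0,1\}$, and $\epsilon_0,\epsilon_1\ge 0$. Put $q=4^{-2Q^{*,sv}_{\epsilon_0,\epsilon_1}(f)}$. 1. There is an XOR-game entangled strategy such that, for every input $(x,y)$: with probability $q$ it outputs a bit that equals $f(x,y)$ with probability at least $1-\epsilon_{f(x,y)}$, and otherwise (with probability $1-q$) it outputs a uniformly random bit. That is, its output distribution on $(x,y)$ is $q\,\mu_{x,y}+(1-q)\,\mathrm{Unif}\{0,1\}$ for a probability distribution $\mu_{x,y}$ on $\{0,1\}$ with $\mu_{x,y}(f(x,y))\ge 1-\epsilon_{f(x,y)}$. 2. There is an AND-game entangled strategy such that, for every input $(x,y)$: with probability $q$ it outputs a bit that equals $f(x,y)$ with probability at least $1-\epsilon_{f(x,y)}$, and otherwise (with probability $1-q$) it outputs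 $0$. That is, its output distribution on $(x,y)$ is $q\,\mu_{x,y}+(1-q)\,\delta_0$ for a probability distribution $\mu_{x,y}$ as in 1. -/

import Mathlib

open scoped Matrix Kronecker

noncomputable section

/-- A two-outcome projective measurement `{M false, M true}` (outcome `false` is the bit `0`,
outcome `true` is the bit `1`) on the space `ℂ^n`. -/
structure IsBinaryMeasurement {n : Type*} [Fintype n] [DecidableEq n]
    (M : Bool → Matrix n n ℂ) : Prop where
  isHermitian : ∀ b, (M b).IsHermitian
  idempotent : ∀ b, M b * M b = M b
  complete : M false + M true = 1

/-- The probability `⟨ψ|P|ψ⟩`. -/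
def bornProb {n : Type*} [Fintype n] (P : Matrix n n ℂ) (ψ : n → ℂ) : ℝ :=
  (star ψ ⬝ᵥ (P *ᵥ ψ)).re

/-! ### The server model -/

/-- A `T`-round quantum protocol with prior entanglement in the server model.

At the beginning of round `t` (rounds are numbered from `0`; "at time `t`"), the registers are
* Carol: private memory of dimension `c t`, the message of dimension `sc t` received last from the
  server, and the `dc t` qubits received last from David;
* David: private memory of dimension `d t`, the message of dimension `sd t` received last from the
  server, and the `cd t` qubits received last from Carol;
* server: private memory of dimension `s t`, the `cs t` qubits received last from Carol, and the
  `ds t` qubits received last from David.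

At time `0` these registers together hold an arbitrary entangled state that does not depend on the
inputs. In each round every party applies a local isometry (a unitary acting also on fresh
ancillas) to all it holds, Carol's depending on `x` and David's on `y`, which produces the new
private memory and the messages to be sent. All messages are then delivered simultaneously. In
every round Carol sends at most one qubit (to David or to the server), and so does David (to Carol
or to the server); the server's messages are unrestricted. The recipients are fixed by the
protocol. At time `T`, Carol and David each measure what they hold to get an output bit. -/
structure ServerProtocol (X Y : Type*) (T : ℕ) where
  /-- dimensions of the private memories of Carol, David and the server -/
  c : ℕ → ℕ
  d : ℕ → ℕ
  s : ℕ → ℕ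
  /-- dimensions of the messages of the server to Carol and to David -/
  sc : ℕ → ℕ
  sd : ℕ → ℕ
  /-- numbers of qubits from Carol to David, Carol to the server, David to Carol, David to the
  server; the values at `t + 1` belong to the messages sent in round `t` -/
  cd : ℕ → ℕ
  cs : ℕ → ℕ
  dc : ℕ → ℕ
  ds : ℕ → ℕ
  carol_le_one : ∀ t, cd (t + 1) + cs (t + 1) ≤ 1
  david_le_one : ∀ t, dc (t + 1) + ds (t + 1) ≤ 1
  /-- the shared initial state -/
  init : (Fin (c 0) × Fin (sc 0) × Fin (2 ^ dc 0)) ×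
    (Fin (d 0) × Fin (sd 0) × Fin (2 ^ cd 0)) ×
    (Fin (s 0) × Fin (2 ^ cs 0) × Fin (2 ^ ds 0)) → ℂ
  init_unit : ∑ i, ‖init i‖ ^ 2 = 1
  /-- Carol's operation in round `t`: new memory, qubits for the server, qubits for David -/
  carolOp : ∀ t, X → Matrix (Fin (c (t + 1)) × Fin (2 ^ cs (t + 1)) × Fin (2 ^ cd (t + 1)))
    (Fin (c t) × Fin (sc t) × Fin (2 ^ dc t)) ℂ
  /-- David's operation in round `t`: new memory, qubits for the server, qubits for Carol -/
  davidOp : ∀ t, Y → Matrix (Fin (d (t + 1)) × Fin (2 ^ ds (t + 1)) × Fin (2 ^ dc (t + 1)))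
    (Fin (d t) × Fin (sd t) × Fin (2 ^ cd t)) ℂ
  /-- the server's operation in round `t`: new memory, message for Carol, message for David -/
  serverOp : ∀ t, Matrix (Fin (s (t + 1)) × Fin (sc (t + 1)) × Fin (sd (t + 1)))
    (Fin (s t) × Fin (2 ^ cs t) × Fin (2 ^ ds t)) ℂ
  carol_isometry : ∀ t x, (carolOp t x)ᴴ * carolOp t x = 1
  david_isometry : ∀ t y, (davidOp t y)ᴴ * davidOp t y = 1
  server_isometry : ∀ t, (serverOp t)ᴴ * serverOp t = 1
  /-- final measurements of Carol and David -/
  carolMeas : X → Bool →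
    Matrix (Fin (c T) × Fin (sc T) × Fin (2 ^ dc T)) (Fin (c T) × Fin (sc T) × Fin (2 ^ dc T)) ℂ
  davidMeas : Y → Bool →
    Matrix (Fin (d T) × Fin (sd T) × Fin (2 ^ cd T)) (Fin (d T) × Fin (sd T) × Fin (2 ^ cd T)) ℂ
  carolMeas_isMeas : ∀ x, IsBinaryMeasurement (carolMeas x)
  davidMeas_isMeas : ∀ y, IsBinaryMeasurement (davidMeas y)

namespace ServerProtocol

variable {X Y : Type*} {T : ℕ} (p : ServerProtocol X Y T)

/-- Index types of the (computational bases of the) registers at time `t`. -/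
abbrev CarolReg (t : ℕ) : Type := Fin (p.c t) × Fin (p.sc t) × Fin (2 ^ p.dc t)
abbrev DavidReg (t : ℕ) : Type := Fin (p.d t) × Fin (p.sd t) × Fin (2 ^ p.cd t)
abbrev ServerReg (t : ℕ) : Type := Fin (p.s t) × Fin (2 ^ p.cs t) × Fin (2 ^ p.ds t)

/-- The global state at time `t` on the inputs `x`, `y`. Passing from time `t` to time `t + 1`, the
three local operations are applied, and then the messages are handed to their recipients. -/
def state (x : X) (y : Y) : (t : ℕ) → p.CarolReg t × p.DavidReg t × p.ServerReg t → ℂ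
  | 0 => p.init
  | t + 1 => fun ((memC, fromS, fromD), (memD, fromS', fromC), (memS, fromC', fromD')) =>
      ((p.carolOp t x ⊗ₖ (p.davidOp t y ⊗ₖ p.serverOp t)) *ᵥ state x y t)
        ((memC, fromC', fromC), (memD, fromD', fromD), (memS, fromS, fromS'))

/-- The probability that Carol outputs `b`. -/
def carolProb (x : X) (y : Y) (b : Bool) : ℝ :=
  bornProb (p.carolMeas x b ⊗ₖ (1 : Matrix (p.DavidReg T × p.ServerReg T) _ ℂ)) (p.state x y T)

/-- The probability that David outputs `b`. -/
def davidProb (x : X) (y : Y) (b : Bool) : ℝ :=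
  bornProb ((1 : Matrix (p.CarolReg T) _ ℂ) ⊗ₖ
    (p.davidMeas y b ⊗ₖ (1 : Matrix (p.ServerReg T) _ ℂ))) (p.state x y T)

/-- The protocol computes `f` with `(ε₀, ε₁)`-error: on every input, each of Carol and David
outputs `f x y` with probability at least `1 - ε₀` if `f x y = 0`, and at least `1 - ε₁` if
`f x y = 1`. -/
def Computes (f : X → Y → Bool) (ε₀ ε₁ : ℝ) : Prop :=
  ∀ x y, 1 - (if f x y then ε₁ else ε₀) ≤ p.carolProb x y (f x y) ∧
    1 - (if f x y then ε₁ else ε₀) ≤ p.davidProb x y (f x y)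

end ServerProtocol

/-! ### The complexity is the minimum of a nonempty set

Each player sends the indicator bits of the own input one after the other. -/

namespace ServerProtocol

/-- The matrix that maps the basis vector `j` to the basis vector `φ j`. -/
def funMat {m n : Type*} [DecidableEq m] (φ : n → m) : Matrix m n ℂ :=
  Matrix.of fun i j => if i = φ j then 1 else 0

theorem funMat_isometry {m n : Type*} [Fintype m] [DecidableEq m] [DecidableEq n]
    {φ : n → m} (h : Function.Injective φ) : (funMat φ)ᴴ * funMat φ = 1 := by
  ext j j'
  simp [funMat, Matrix.mul_apply, Matrix.one_apply, h.eq_iff, eq_comm]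

theorem funMat_kronecker {m n m' n' : Type*} [DecidableEq m] [DecidableEq m']
    (φ : n → m) (χ : n' → m') :
    funMat φ ⊗ₖ funMat χ = funMat (Prod.map φ χ) := by
  ext ⟨i, i'⟩ ⟨j, j'⟩
  simp only [funMat, Matrix.kroneckerMap_apply, Matrix.of_apply, Prod.map, Prod.mk.injEq]
  split_ifs <;> simp_all

theorem funMat_mulVec {m n : Type*} [Fintype n] [DecidableEq m] [DecidableEq n]
    (φ : n → m) (j : n) :
    funMat φ *ᵥ (fun i => if i = j then 1 else 0) = fun i => if i = φ j then 1 else 0 := by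
  ext i
  simp [funMat, Matrix.mulVec, dotProduct]

/-- The measurement in the computational basis followed by the classical function `o`. -/
def outMeas {n : Type*} [DecidableEq n] (o : n → Bool) (b : Bool) : Matrix n n ℂ :=
  Matrix.diagonal fun j => if o j = b then 1 else 0

theorem outMeas_isMeas {n : Type*} [Fintype n] [DecidableEq n] (o : n → Bool) :
    IsBinaryMeasurement (outMeas o) where
  isHermitian b := by
    rw [Matrix.IsHermitian, outMeas, Matrix.diagonal_conjTranspose]
    congr 1
    ext j
    by_cases h : o j = b <;> simp [h]
  idempotent b := by simp [outMeas, Matrix.diagonal_mul_diagonal]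
  complete := by
    ext i j
    by_cases hij : i = j
    · subst hij
      cases h : o i <;> simp [outMeas, h]
    · simp [outMeas, hij]

theorem outMeas_kronecker {m n : Type*} [DecidableEq m] [DecidableEq n] (o : n → Bool) (b : Bool) :
    outMeas o b ⊗ₖ (1 : Matrix m m ℂ) = outMeas (fun j => o j.1) b := by
  rw [outMeas, ← Matrix.diagonal_one, Matrix.diagonal_kronecker_diagonal]
  simp [outMeas]

theorem kronecker_outMeas {m n : Type*} [DecidableEq m] [DecidableEq n] (o : n → Bool) (b : Bool) :
    (1 : Matrix m m ℂ) ⊗ₖ outMeas o b = outMeas (fun j => o j.2) b := by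
  rw [outMeas, ← Matrix.diagonal_one, Matrix.diagonal_kronecker_diagonal]
  simp [outMeas]

theorem bornProb_outMeas {n : Type*} [Fintype n] [DecidableEq n] (o : n → Bool) (b : Bool)
    (j : n) (h : o j = b) : bornProb (outMeas o b) (fun i => if i = j then 1 else 0) = 1 := by
  simp [bornProb, outMeas, dotProduct, Matrix.mulVec_diagonal, h]

/-- Appending a received bit to the memory. -/
def enc (t : ℕ) : Fin (2 ^ t) × Fin (2 ^ 1) ≃ Fin (2 ^ (t + 1)) :=
  finProdFinEquiv.trans (finCongr (by ring))

/-- The bit received last at time `t`, if the bits `β` are sent. -/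
def recv (β : ℕ → Fin (2 ^ 1)) : ℕ → Fin (2 ^ 1)
  | 0 => 0
  | t + 1 => β t

/-- The memory at time `t`. -/
def mem (β : ℕ → Fin (2 ^ 1)) : (t : ℕ) → Fin (2 ^ t)
  | 0 => 0
  | t + 1 => enc t (mem β t, recv β t)

theorem recv_eq_of_mem_eq {β γ : ℕ → Fin (2 ^ 1)} :
    ∀ t, mem β t = mem γ t → ∀ u < t, recv β u = recv γ u
  | 0, _, u, hu => by omega
  | t + 1, h, u, hu => by
    have h' := (enc t).injective h
    rw [Prod.mk.injEq] at h'
    rcases Nat.lt_succ_iff_lt_or_eq.mp hu with hu | rfl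
    · exact recv_eq_of_mem_eq t h'.1 u hu
    · exact h'.2

/-- The local operation of a player who sends the bit `b` to the other player. -/
def step (t : ℕ) (b : Fin (2 ^ 1)) (j : Fin (2 ^ t) × Fin 1 × Fin (2 ^ 1)) :
    Fin (2 ^ (t + 1)) × Fin (2 ^ 0) × Fin (2 ^ 1) :=
  (enc t (j.1, j.2.2), 0, b)

theorem step_injective (t : ℕ) (b : Fin (2 ^ 1)) : Function.Injective (step t b) := by
  rintro ⟨k, m, q⟩ ⟨k', m', q'⟩ h
  simp only [step, Prod.mk.injEq, EmbeddingLike.apply_eq_iff_eq] at h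
  obtain ⟨⟨rfl, rfl⟩, -⟩ := h
  simp [Subsingleton.elim m m']

/-- The players send the bits `β x t`, `γ y t` in round `t`, and apply the functions `oC`, `oD` to
their memories at the end. -/
def exchange {X Y : Type*} (T : ℕ) (β : X → ℕ → Fin (2 ^ 1)) (γ : Y → ℕ → Fin (2 ^ 1))
    (oC : X → Fin (2 ^ T) → Bool) (oD : Y → Fin (2 ^ T) → Bool) : ServerProtocol X Y T where
  c t := 2 ^ t
  d t := 2 ^ t
  s _ := 1
  sc _ := 1
  sd _ := 1
  cd _ := 1
  cs _ := 0
  dc _ := 1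
  ds _ := 0
  carol_le_one _ := by norm_num
  david_le_one _ := by norm_num
  init := fun i => if i = ((0, 0, 0), (0, 0, 0), (0, 0, 0)) then 1 else 0
  init_unit := by
    rw [Finset.sum_eq_single ((0, 0, 0), (0, 0, 0), (0, 0, 0))]
    · simp
    · intro b _ hb
      simp [hb]
    · simp
  carolOp t x := funMat (step t (β x t))
  davidOp t y := funMat (step t (γ y t))
  serverOp _ := funMat fun _ => (0, 0, 0)
  carol_isometry t x := funMat_isometry (step_injective t _)
  david_isometry t y := funMat_isometry (step_injective t _)
  server_isometry t := funMat_isometry (by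
    have : Subsingleton (Fin (2 ^ 0)) := inferInstanceAs (Subsingleton (Fin 1))
    exact Function.injective_of_subsingleton _)
  carolMeas x := outMeas fun j => oC x j.1
  davidMeas y := outMeas fun j => oD y j.1
  carolMeas_isMeas _ := outMeas_isMeas _
  davidMeas_isMeas _ := outMeas_isMeas _

theorem deliver_eq_iff {α α' α'' δ δ' δ'' σ σ' σ'' : Type*} {a A : α} {a' A' : α'} {a'' A'' : α''}
    {b B : δ} {b' B' : δ'} {b'' B'' : δ''} {e E : σ} {e' E' : σ'} {e'' E'' : σ''} :
    ((a, e', b''), (b, e'', a''), (e, a', b')) = ((A, E', B''), (B, E'', A''), (E, A', B')) ↔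
      ((a, a', a''), (b, b', b''), (e, e', e'')) = ((A, A', A''), (B, B', B''), (E, E', E'')) := by
  simp only [Prod.mk.injEq]
  tauto

theorem exchange_state {X Y : Type*} (T : ℕ) (β : X → ℕ → Fin (2 ^ 1)) (γ : Y → ℕ → Fin (2 ^ 1))
    (oC : X → Fin (2 ^ T) → Bool) (oD : Y → Fin (2 ^ T) → Bool) (x : X) (y : Y) :
    ∀ t, (exchange T β γ oC oD).state x y t = fun i =>
      if i = ((mem (γ y) t, (0 : Fin 1), recv (γ y) t), (mem (β x) t, (0 : Fin 1), recv (β x) t),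
        ((0 : Fin 1), (0 : Fin (2 ^ 0)), (0 : Fin (2 ^ 0)))) then 1 else 0
  | 0 => rfl
  | t + 1 => by
    have h : (exchange T β γ oC oD).state x y (t + 1) = fun i =>
        ((funMat (step t (β x t)) ⊗ₖ (funMat (step t (γ y t)) ⊗ₖ
          funMat (fun _ : Fin 1 × Fin (2 ^ 0) × Fin (2 ^ 0) =>
            ((0, 0, 0) : Fin 1 × Fin 1 × Fin 1)))) *ᵥ
          (exchange T β γ oC oD).state x y t)
        ((i.1.1, i.2.2.2.1, i.2.1.2.2), (i.2.1.1, i.2.2.2.2, i.1.2.2),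
          (i.2.2.1, i.1.2.1, i.2.1.2.1)) := rfl
    rw [h, exchange_state T β γ oC oD x y t, funMat_kronecker, funMat_kronecker, funMat_mulVec]
    funext ⟨⟨a, a', a''⟩, ⟨b, b', b''⟩, ⟨e, e', e''⟩⟩
    exact @if_congr _ _ _ (_) (_) _ _ _ _ deliver_eq_iff rfl rfl

end ServerProtocol

open ServerProtocol in
theorem exists_serverProtocol_computes {X Y : Type*} [Finite X] [Finite Y] (f : X → Y → Bool)
    {ε₀ ε₁ : ℝ} (hε₀ : 0 ≤ ε₀) (hε₁ : 0 ≤ ε₁) :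
    ∃ (T : ℕ) (p : ServerProtocol X Y T), p.Computes f ε₀ ε₁ := by
  classical
  obtain ⟨m, ⟨eX⟩⟩ := Finite.exists_equiv_fin X
  obtain ⟨n, ⟨eY⟩⟩ := Finite.exists_equiv_fin Y
  let β : X → ℕ → Fin (2 ^ 1) := fun x t => if (eX x : ℕ) = t then 1 else 0
  let γ : Y → ℕ → Fin (2 ^ 1) := fun y t => if (eY y : ℕ) = t then 1 else 0
  let T := m + n + 1
  have hβ : ∀ x x', mem (β x) T = mem (β x') T → x = x' := by
    intro x x' h
    have h1 := recv_eq_of_mem_eq T h (eX x + 1) (by have := (eX x).2; omega)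
    by_contra hne
    have : (eX x' : ℕ) ≠ eX x := fun h => hne (eX.injective (Fin.ext h.symm))
    simp [recv, β, this] at h1
  have hγ : ∀ y y', mem (γ y) T = mem (γ y') T → y = y' := by
    intro y y' h
    have h1 := recv_eq_of_mem_eq T h (eY y + 1) (by have := (eY y).2; omega)
    by_contra hne
    have : (eY y' : ℕ) ≠ eY y := fun h => hne (eY.injective (Fin.ext h.symm))
    simp [recv, γ, this] at h1
  let oC : X → Fin (2 ^ T) → Bool := fun x k => decide (∃ y, mem (γ y) T = k ∧ f x y = true)
  let oD : Y → Fin (2 ^ T) → Bool := fun y k => decide (∃ x, mem (β x) T = k ∧ f x y = true)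
  have hoC : ∀ x y, oC x (mem (γ y) T) = f x y := by
    intro x y
    rw [Bool.eq_iff_iff]
    simp only [oC, decide_eq_true_eq]
    exact ⟨fun ⟨y', h, h'⟩ => hγ _ _ h ▸ h', fun h => ⟨y, rfl, h⟩⟩
  have hoD : ∀ x y, oD y (mem (β x) T) = f x y := by
    intro x y
    rw [Bool.eq_iff_iff]
    simp only [oD, decide_eq_true_eq]
    exact ⟨fun ⟨x', h, h'⟩ => hβ _ _ h ▸ h', fun h => ⟨x, rfl, h⟩⟩
  refine ⟨T, exchange T β γ oC oD, fun x y => ?_⟩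
  have hε : 1 - (if f x y then ε₁ else ε₀) ≤ 1 := by split_ifs <;> linarith
  have hC : (exchange T β γ oC oD).carolProb x y (f x y) = 1 := by
    rw [carolProb, exchange_state]
    refine (congrArg (bornProb · _) (outMeas_kronecker _ _)).trans ?_
    exact bornProb_outMeas _ _ _ (hoC x y)
  have hD : (exchange T β γ oC oD).davidProb x y (f x y) = 1 := by
    rw [davidProb, exchange_state]
    refine (congrArg (bornProb · _) ((congrArg (1 ⊗ₖ ·) (outMeas_kronecker _ _)).trans
      (kronecker_outMeas _ _))).trans ?_
    exact bornProb_outMeas _ _ _ (hoD x y)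
  exact ⟨hε.trans hC.ge, hε.trans hD.ge⟩

/-- The `(ε₀, ε₁)`-error quantum communication complexity of `f` in the server model with
entanglement: the least number of rounds of a protocol that computes `f`. (If the input sets are
finite and the errors are nonnegative there is such a protocol, see
`exists_serverProtocol_computes`.) -/
def serverComplexity {X Y : Type*} (f : X → Y → Bool) (ε₀ ε₁ : ℝ) : ℕ :=
  sInf {T : ℕ | ∃ p : ServerProtocol X Y T, p.Computes f ε₀ ε₁}

/-! ### Nonlocal games -/

/-- An entangled strategy of two players, Alice and Bob: a shared pure state in `ℂ^d ⊗ ℂ^d` and,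
for every input, a projective measurement with outcomes in `{0, 1}` for each player. -/
structure EntangledStrategy (X Y : Type*) where
  d : ℕ
  ψ : Fin d × Fin d → ℂ
  ψ_unit : ∑ i, ‖ψ i‖ ^ 2 = 1
  A : X → Bool → Matrix (Fin d) (Fin d) ℂ
  B : Y → Bool → Matrix (Fin d) (Fin d) ℂ
  A_isMeas : ∀ x, IsBinaryMeasurement (A x)
  B_isMeas : ∀ y, IsBinaryMeasurement (B y)

namespace EntangledStrategy

variable {X Y : Type*} (S : EntangledStrategy X Y)

/-- The probability that Alice answers `a` and Bob answers `b` on the inputs `x`, `y`. -/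
def prob (x : X) (y : Y) (a b : Bool) : ℝ := bornProb (S.A x a ⊗ₖ S.B y b) S.ψ

/-- The probability that the output `g a b` of the game equals `o`. -/
def outputProb (g : Bool → Bool → Bool) (x : X) (y : Y) (o : Bool) : ℝ :=
  ∑ a, ∑ b, if g a b = o then S.prob x y a b else 0

end EntangledStrategy

/-- The output distribution of the strategy `S`, in the game where the referee combines the answers
by `g`, is: with probability `q` a bit that equals `f x y` with probability at least `1 - ε₀` if
`f x y = 0` and at least `1 - ε₁` if `f x y = 1`; otherwise a bit with distribution `other`. -/
def SimulatesWithProb {X Y : Type*} (S : EntangledStrategy X Y) (g : Bool → Bool → Bool)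
    (f : X → Y → Bool) (ε₀ ε₁ q : ℝ) (other : Bool → ℝ) : Prop :=
  ∀ x y, ∃ good : Bool → ℝ, (∀ o, 0 ≤ good o) ∧ good false + good true = 1 ∧
    1 - (if f x y then ε₁ else ε₀) ≤ good (f x y) ∧
    ∀ o, S.outputProb g x y o = q * good o + (1 - q) * other o

end

/-!
The statement is the translation of a protocol into a nonlocal game by postselected teleportation.

A qubit can be moved from one party to another without communication: the parties share a maximally
entangled pair, and the sender projects the qubit and the own half of the pair onto the maximally
entangled state. The receiver then holds the qubit, with amplitude `1/2`, that is, with probability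
`1/4`, and no correction is needed in this case. As the server has no input, its operations can be
applied in advance, to halves of such pairs in place of the qubits of the players. Thus the server's
messages become part of the state that Alice (for Carol) and Bob (for David) share, and Bob may keep
the server's private memory. Carol's and David's local operations together with the projections are
contractions `W x` and `V y` such that `(W x ⊗ V y) ψ` is a multiple of the final state of the
protocol (`ServerProtocol.PostselectedSimulation`). At most two qubits are sent in a round, so that
the factor is at least `4 ^ (-T)` after `T` rounds, and it can be rescaled to be `4 ^ (-T)`. Both
players succeed with probability `4 ^ (-2 * T)`, and the state is then that of the protocol
(`ServerProtocol.exists_contractions_bornProb_eq`).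

Only Carol's outcome is used. In the AND game Alice answers `1` if she succeeds and Carol's outcome
is `1`, and Bob answers `1` if he succeeds. In the XOR game a player who does not succeed answers a
random bit, which makes the output uniformly random; otherwise Alice answers Carol's outcome and Bob
answers `0`. The two-outcome measurements that arise are not projective, but they become so by a
Naimark dilation (`exists_entangledStrategy_prob_eq`).
-/

noncomputable section

/-! ### Born probabilities -/

theorem bornProb_conj {m n : Type*} [Fintype m] [Fintype n] (H : Matrix m n ℂ)
    (P : Matrix m m ℂ) (ψ : n → ℂ) : bornProb (Hᴴ * P * H) ψ = bornProb P (H *ᵥ ψ) := by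
  simp only [bornProb, Matrix.star_mulVec, ← Matrix.mulVec_mulVec, Matrix.dotProduct_mulVec,
    Matrix.vecMul_vecMul]

theorem bornProb_one {n : Type*} [Fintype n] [DecidableEq n] (ψ : n → ℂ) :
    bornProb 1 ψ = ∑ i, ‖ψ i‖ ^ 2 := by
  simp [bornProb, dotProduct, ← Complex.normSq_eq_norm_sq, Complex.normSq_apply]

theorem bornProb_add {n : Type*} [Fintype n] (P Q : Matrix n n ℂ) (ψ : n → ℂ) :
    bornProb (P + Q) ψ = bornProb P ψ + bornProb Q ψ := by
  simp [bornProb, Matrix.add_mulVec]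

theorem bornProb_sub {n : Type*} [Fintype n] (P Q : Matrix n n ℂ) (ψ : n → ℂ) :
    bornProb (P - Q) ψ = bornProb P ψ - bornProb Q ψ := by
  simp [bornProb, Matrix.sub_mulVec]

theorem bornProb_smul {n : Type*} [Fintype n] (r : ℝ) (P : Matrix n n ℂ) (ψ : n → ℂ) :
    bornProb (r • P) ψ = r * bornProb P ψ := by
  simp [bornProb, Matrix.smul_mulVec]

theorem bornProb_smul_right {n : Type*} [Fintype n] (r : ℝ) (P : Matrix n n ℂ) (ψ : n → ℂ) :
    bornProb P (r • ψ) = r ^ 2 * bornProb P ψ := by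
  have : star (r • ψ) = r • star ψ := by ext i; simp
  rw [bornProb, this, Matrix.mulVec_smul, smul_dotProduct, dotProduct_smul, bornProb]
  simp; ring

theorem IsBinaryMeasurement.bornProb_nonneg {n : Type*} [Fintype n] [DecidableEq n]
    {M : Bool → Matrix n n ℂ} (hM : IsBinaryMeasurement M) (b : Bool) (ψ : n → ℂ) :
    0 ≤ bornProb (M b) ψ := by
  have h : M b = (M b)ᴴ * 1 * M b := by rw [(hM.isHermitian b).eq, mul_one, hM.idempotent]
  rw [h, bornProb_conj, bornProb_one]
  positivity

open scoped ComplexOrder in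
theorem IsBinaryMeasurement.posSemidef {n : Type*} [Fintype n] [DecidableEq n]
    {M : Bool → Matrix n n ℂ} (hM : IsBinaryMeasurement M) (b : Bool) : (M b).PosSemidef := by
  have h : M b = (M b)ᴴ * M b := by rw [(hM.isHermitian b).eq, hM.idempotent]
  rw [h]
  exact Matrix.posSemidef_conjTranspose_mul_self _

theorem IsBinaryMeasurement.conj_add {m n : Type*} [Fintype m] [DecidableEq m]
    {M : Bool → Matrix m m ℂ} (hM : IsBinaryMeasurement M) (W : Matrix m n ℂ) :
    Wᴴ * W = Wᴴ * M false * W + Wᴴ * M true * W := by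
  rw [← Matrix.add_mul, ← Matrix.mul_add, hM.complete, Matrix.mul_one]

theorem EntangledStrategy.sum_prob {X Y : Type*} (S : EntangledStrategy X Y) (x : X) (y : Y) :
    ∑ a, ∑ b, S.prob x y a b = 1 := by
  simp only [EntangledStrategy.prob, Fintype.sum_bool, ← bornProb_add, ← Matrix.kronecker_add,
    ← Matrix.add_kronecker, add_comm _ (S.A x false), add_comm _ (S.B y false),
    (S.A_isMeas x).complete, (S.B_isMeas y).complete, Matrix.one_kronecker_one, bornProb_one,
    S.ψ_unit]

/-! ### Contractions -/

/-- `W` does not increase the Euclidean norm. -/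
def IsContraction {m n : Type*} [Fintype m] [Fintype n] (W : Matrix m n ℂ) : Prop :=
  ∀ v, ∑ i, ‖(W *ᵥ v) i‖ ^ 2 ≤ ∑ j, ‖v j‖ ^ 2

theorem sum_norm_sq_mulVec_of_isometry {m n : Type*} [Fintype m] [Fintype n] [DecidableEq n]
    {U : Matrix m n ℂ} (hU : Uᴴ * U = 1) (v : n → ℂ) :
    ∑ i, ‖(U *ᵥ v) i‖ ^ 2 = ∑ j, ‖v j‖ ^ 2 := by
  classical
  rw [← bornProb_one, ← bornProb_conj, Matrix.mul_one, hU, bornProb_one]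

theorem IsContraction.of_isometry {m n : Type*} [Fintype m] [Fintype n] [DecidableEq n]
    {U : Matrix m n ℂ} (hU : Uᴴ * U = 1) : IsContraction U :=
  fun v => (sum_norm_sq_mulVec_of_isometry hU v).le

theorem IsContraction.mul {l m n : Type*} [Fintype l] [Fintype m] [Fintype n]
    {U : Matrix l m ℂ} {W : Matrix m n ℂ} (hU : IsContraction U) (hW : IsContraction W) :
    IsContraction (U * W) := fun v => by
  rw [← Matrix.mulVec_mulVec]
  exact (hU _).trans (hW v)

theorem IsContraction.smul {m n : Type*} [Fintype m] [Fintype n] {W : Matrix m n ℂ}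
    (hW : IsContraction W) {r : ℝ} (h0 : 0 ≤ r) (h1 : r ≤ 1) : IsContraction (r • W) := fun v => by
  refine le_trans (Finset.sum_le_sum fun i _ => ?_) (hW v)
  rw [Matrix.smul_mulVec, Pi.smul_apply, norm_smul, Real.norm_of_nonneg h0]
  gcongr
  exact mul_le_of_le_one_left (norm_nonneg _) h1

open scoped ComplexOrder in
theorem IsContraction.posSemidef {m n : Type*} [Fintype m] [Fintype n] [DecidableEq n]
    {W : Matrix m n ℂ} (hW : IsContraction W) : (1 - Wᴴ * W).PosSemidef := by
  classical
  have hH : (1 - Wᴴ * W).IsHermitian :=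
    Matrix.isHermitian_one.sub (Matrix.isHermitian_conjTranspose_mul_self W)
  refine Matrix.PosSemidef.of_dotProduct_mulVec_nonneg hH fun v => ?_
  have him : (star v ⬝ᵥ ((1 - Wᴴ * W) *ᵥ v)).im = 0 := hH.im_star_dotProduct_mulVec_self v
  have hre : 0 ≤ bornProb (1 - Wᴴ * W) v := by
    have h := bornProb_conj W 1 v
    rw [Matrix.mul_one, bornProb_one] at h
    rw [bornProb_sub, bornProb_one, h]
    exact sub_nonneg.mpr (hW v)
  rw [Complex.nonneg_iff]
  exact ⟨hre, him.symm⟩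

theorem IsContraction.kronecker_one {m n k : Type*} [Fintype m] [Fintype n] [Fintype k]
    [DecidableEq k] {W : Matrix m n ℂ} (hW : IsContraction W) :
    IsContraction (W ⊗ₖ (1 : Matrix k k ℂ)) := fun v => by
  have h : ∀ i c, ((W ⊗ₖ (1 : Matrix k k ℂ)) *ᵥ v) (i, c) = (W *ᵥ fun a => v (a, c)) i := by
    intro i c
    simp [Matrix.mulVec, dotProduct, Fintype.sum_prod_type, Matrix.one_apply]
  simp only [Fintype.sum_prod_type_right, h]
  exact Finset.sum_le_sum fun c _ => hW _

/-! ### Naimark dilation of two-outcome measurements -/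

open scoped MatrixOrder ComplexOrder in
/-- The product `E * (1 - E)` is positive semidefinite, and its square root commutes with `E`. This
is the off-diagonal block of the projection that dilates `E`. -/
theorem exists_isHermitian_mul_self_eq {n : Type*} [Fintype n] [DecidableEq n] {E : Matrix n n ℂ}
    (h0 : E.PosSemidef) (h1 : (1 - E).PosSemidef) :
    ∃ S : Matrix n n ℂ, S.IsHermitian ∧ S * S = E * (1 - E) ∧ E * S = S * E := by
  have hG : (E * (1 - E)).PosSemidef := by
    have h := (h1.conjTranspose_mul_mul_same E).add (h0.conjTranspose_mul_mul_same (1 - E))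
    rw [h0.isHermitian.eq, h1.isHermitian.eq] at h
    convert h using 1
    noncomm_ring
  have hG' : 0 ≤ E * (1 - E) := Matrix.nonneg_iff_posSemidef.mpr hG
  have hc : Commute (E * (1 - E)) E := by
    show E * (1 - E) * E = E * (E * (1 - E))
    noncomm_ring
  exact ⟨CFC.sqrt (E * (1 - E)), (CFC.sqrt_nonneg _).isSelfAdjoint, CFC.sqrt_mul_sqrt_self _ hG',
    (hc.cfcₙ_nnreal _).symm.eq⟩

/-- The two-outcome measurement with the effect `E` for the outcome `true` and `1 - E` for the
outcome `false`. -/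
def effectPair {n : Type*} [DecidableEq n] (E : Matrix n n ℂ) (b : Bool) : Matrix n n ℂ :=
  if b then E else 1 - E

theorem effectPair_isMeas {n : Type*} [Fintype n] [DecidableEq n]
    {P : Matrix n n ℂ} (hH : P.IsHermitian) (hP : P * P = P) :
    IsBinaryMeasurement (effectPair P) where
  isHermitian b := by
    cases b <;> simp [effectPair, hH, (Matrix.isHermitian_one (n := n) (α := ℂ)).sub hH]
  idempotent b := by cases b <;> simp [effectPair, hP, mul_sub, sub_mul]
  complete := by simp [effectPair]

open scoped ComplexOrder in
/-- An effect `E` is the corner of a projection, namely of `[[E, S], [S, 1 - E]]` with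
`S * S = E * (1 - E)`. -/
theorem exists_projection_compression_eq {n : Type*} [Fintype n] [DecidableEq n] {E : Matrix n n ℂ}
    (h0 : E.PosSemidef) (h1 : (1 - E).PosSemidef) :
    ∃ P : Matrix (n ⊕ n) (n ⊕ n) ℂ, P.IsHermitian ∧ P * P = P ∧ P.toBlocks₁₁ = E := by
  obtain ⟨S, hS, hSS, hc⟩ := exists_isHermitian_mul_self_eq h0 h1
  refine ⟨Matrix.fromBlocks E S S (1 - E), ?_, ?_, by simp⟩
  · rw [Matrix.IsHermitian, Matrix.fromBlocks_conjTranspose, h0.isHermitian.eq, hS.eq,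
      h1.isHermitian.eq]
  · rw [Matrix.fromBlocks_multiply, hSS]
    congr 1
    · noncomm_ring
    · rw [hc]; noncomm_ring
    · rw [← hc]; noncomm_ring
    · noncomm_ring

open ServerProtocol in
theorem funMat_mul_funMat {l m n : Type*} [Fintype m] [DecidableEq l] [DecidableEq m]
    (φ : m → l) (χ : n → m) : funMat φ * funMat χ = funMat (φ ∘ χ) := by
  ext i j
  simp [funMat, Matrix.mul_apply]

open ServerProtocol in
open scoped ComplexOrder in
/-- Naimark dilation of a two-outcome measurement, along a given embedding of the doubled index type
into a larger one. -/
theorem exists_isBinaryMeasurement_compression_eq {m n : Type*} [Fintype m] [DecidableEq m]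
    [Fintype n] [DecidableEq n] (ι : n ⊕ n ↪ m) {E : Matrix n n ℂ}
    (h0 : E.PosSemidef) (h1 : (1 - E).PosSemidef) :
    ∃ M : Bool → Matrix m m ℂ, IsBinaryMeasurement M ∧
      ∀ b, (funMat (ι ∘ Sum.inl))ᴴ * M b * funMat (ι ∘ Sum.inl) = effectPair E b := by
  obtain ⟨P, hH, hP, hE⟩ := exists_projection_compression_eq h0 h1
  have hJ : (funMat ι)ᴴ * funMat ι = 1 := funMat_isometry ι.injective
  have hV : (funMat (ι ∘ Sum.inl))ᴴ * funMat (ι ∘ Sum.inl) = (1 : Matrix n n ℂ) :=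
    funMat_isometry (ι.injective.comp Sum.inl_injective)
  -- Naming the rectangular factors fixes their types, so that `*` is the product of matrices.
  obtain ⟨I, hI⟩ : ∃ I : Matrix (n ⊕ n) n ℂ, I = funMat Sum.inl := ⟨_, rfl⟩
  have hIP : Iᴴ * P * I = E := by
    rw [← hE]
    ext i j
    simp [hI, funMat, Matrix.mul_apply, Matrix.toBlocks₁₁]
  obtain ⟨J, hJ'⟩ : ∃ J : Matrix m (n ⊕ n) ℂ, J = funMat ι := ⟨_, rfl⟩
  rw [← hJ'] at hJ
  have hM : (funMat (ι ∘ Sum.inl))ᴴ * (J * P * Jᴴ) * funMat (ι ∘ Sum.inl) = E := by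
    rw [← funMat_mul_funMat, ← hJ', ← hI, Matrix.conjTranspose_mul]
    calc _ = Iᴴ * (Jᴴ * J) * P * (Jᴴ * J) * I := by simp only [Matrix.mul_assoc]
      _ = E := by rw [hJ, Matrix.mul_one, Matrix.mul_one, hIP]
  refine ⟨effectPair (J * P * Jᴴ), effectPair_isMeas ?_ ?_, fun b => ?_⟩
  · exact Matrix.isHermitian_mul_mul_conjTranspose J hH
  · calc _ = J * P * (Jᴴ * J) * P * Jᴴ := by simp only [Matrix.mul_assoc]
      _ = _ := by rw [hJ, Matrix.mul_one, Matrix.mul_assoc J P P, hP]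
  · cases b
    · simp [effectPair, Matrix.mul_sub, Matrix.sub_mul, hM, hV]
    · simp [effectPair, hM]

open ServerProtocol in
open scoped ComplexOrder in
/-- General two-outcome measurements on a bipartite state with finite-dimensional sides of different
dimensions can be realised by an entangled strategy. -/
theorem exists_entangledStrategy_prob_eq {X Y α β : Type*} [Fintype α] [DecidableEq α]
    [Fintype β] [DecidableEq β] (ψ : α × β → ℂ) (hψ : ∑ i, ‖ψ i‖ ^ 2 = 1)
    (E : X → Matrix α α ℂ) (F : Y → Matrix β β ℂ)
    (hE : ∀ x, (E x).PosSemidef) (hE' : ∀ x, (1 - E x).PosSemidef)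
    (hF : ∀ y, (F y).PosSemidef) (hF' : ∀ y, (1 - F y).PosSemidef) :
    ∃ S : EntangledStrategy X Y, ∀ x y a b,
      S.prob x y a b = bornProb (effectPair (E x) a ⊗ₖ effectPair (F y) b) ψ := by
  obtain ⟨ι⟩ : Nonempty (α ⊕ α ↪ Fin (Fintype.card (α ⊕ α) + Fintype.card (β ⊕ β))) :=
    Function.Embedding.nonempty_of_card_le (by simp)
  obtain ⟨κ⟩ : Nonempty (β ⊕ β ↪ Fin (Fintype.card (α ⊕ α) + Fintype.card (β ⊕ β))) :=
    Function.Embedding.nonempty_of_card_le (by simp)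
  choose A hA hAE using fun x => exists_isBinaryMeasurement_compression_eq ι (hE x) (hE' x)
  choose B hB hBF using fun y => exists_isBinaryMeasurement_compression_eq κ (hF y) (hF' y)
  have hV : (funMat (ι ∘ Sum.inl) ⊗ₖ funMat (κ ∘ Sum.inl))ᴴ *
      (funMat (ι ∘ Sum.inl) ⊗ₖ funMat (κ ∘ Sum.inl)) = (1 : Matrix (α × β) (α × β) ℂ) := by
    rw [funMat_kronecker]
    exact funMat_isometry ((ι.injective.comp Sum.inl_injective).prodMap
      (κ.injective.comp Sum.inl_injective))
  refine ⟨⟨_, (funMat (ι ∘ Sum.inl) ⊗ₖ funMat (κ ∘ Sum.inl)) *ᵥ ψ, ?_, A, B, hA, hB⟩, ?_⟩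
  · rw [sum_norm_sq_mulVec_of_isometry hV, hψ]
  · intro x y a b
    rw [EntangledStrategy.prob, ← bornProb_conj, Matrix.conjTranspose_kronecker,
      ← Matrix.mul_kronecker_mul, ← Matrix.mul_kronecker_mul, hAE, hBF]

/-! ### One round of postselected teleportation -/

theorem kronecker_kronecker_mulVec {l m n l' m' n' : Type*} [Fintype l'] [Fintype m'] [Fintype n']
    (A : Matrix l l' ℂ) (B : Matrix m m' ℂ) (C : Matrix n n' ℂ) (v : l' × m' × n' → ℂ)
    (i : l) (j : m) (k : n) :
    ((A ⊗ₖ (B ⊗ₖ C)) *ᵥ v) (i, j, k) =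
      ∑ a, A i a * ∑ b, B j b * ∑ c, C k c * v (a, b, c) := by
  simp only [Matrix.mulVec, dotProduct, Fintype.sum_prod_type, Matrix.kroneckerMap_apply,
    Finset.mul_sum, mul_assoc]

/-- One player's side of a round of postselected teleportation. The local operation `U` of the
player yields a new memory and an outgoing register with basis `Q`; the amplitude of the maximally
entangled state between this register and the player's half (the middle factor of the source) of a
maximally entangled pair is taken. The incoming register with basis `R` is in place already. -/
def teleportMat {M Q R A : Type*} [Fintype Q] [DecidableEq R] (U : Matrix (M × Q) A ℂ) :
    Matrix (M × R) (A × Q × R) ℂ :=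
  Matrix.of fun i a =>
    if i.2 = a.2.2 then ((√(Fintype.card Q))⁻¹ : ℝ) * U (i.1, a.2.1) a.1 else 0

theorem teleportMat_mulVec {M Q R A : Type*} [Fintype Q] [Fintype R] [DecidableEq R] [Fintype A]
    (U : Matrix (M × Q) A ℂ) (v : A × Q × R → ℂ) (m : M) (r : R) :
    (teleportMat U *ᵥ v) (m, r) =
      ((√(Fintype.card Q))⁻¹ : ℝ) * ∑ q, (U *ᵥ fun a => v (a, q, r)) (m, q) := by
  simp only [Matrix.mulVec, dotProduct, teleportMat, Matrix.of_apply, Fintype.sum_prod_type,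
    ite_mul, zero_mul, Finset.sum_ite_eq, Finset.mem_univ, if_true, Finset.mul_sum, mul_assoc]
  exact Finset.sum_comm

theorem IsContraction.teleportMat {M Q R A : Type*} [Fintype M] [Fintype Q] [Fintype R]
    [DecidableEq R] [Fintype A] {U : Matrix (M × Q) A ℂ} (hU : IsContraction U) :
    IsContraction (teleportMat (R := R) U) := fun v => by
  -- By the Cauchy-Schwarz inequality the sum over `Q` costs a factor `Fintype.card Q`.
  have hcs : ∀ (m : M) (r : R), ‖(_root_.teleportMat U *ᵥ v) (m, r)‖ ^ 2 ≤
      ∑ q, ‖(U *ᵥ fun a => v (a, q, r)) (m, q)‖ ^ 2 := by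
    intro m r
    rw [teleportMat_mulVec, norm_mul, mul_pow, Complex.norm_real, Real.norm_eq_abs, sq_abs, inv_pow,
      Real.sq_sqrt (Nat.cast_nonneg _)]
    refine inv_mul_le_of_le_mul₀ (Nat.cast_nonneg _) (by positivity) ?_
    refine le_trans (pow_le_pow_left₀ (norm_nonneg _) (norm_sum_le _ _) 2) ?_
    exact sq_sum_le_card_mul_sum_sq
  calc ∑ i, ‖(_root_.teleportMat U *ᵥ v) i‖ ^ 2
      ≤ ∑ i : M × R, ∑ q, ‖(U *ᵥ fun a => v (a, q, i.2)) (i.1, q)‖ ^ 2 :=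
        Finset.sum_le_sum fun i _ => hcs i.1 i.2
    _ = ∑ r, ∑ q, ∑ m, ‖(U *ᵥ fun a => v (a, q, r)) (m, q)‖ ^ 2 := by
        rw [Fintype.sum_prod_type_right]
        exact Finset.sum_congr rfl fun r _ => Finset.sum_comm
    _ ≤ ∑ r, ∑ q, ∑ i : M × Q, ‖(U *ᵥ fun a => v (a, q, r)) i‖ ^ 2 := by
        refine Finset.sum_le_sum fun r _ => Finset.sum_le_sum fun q _ => ?_
        rw [Fintype.sum_prod_type]
        exact Finset.sum_le_sum fun m _ => Finset.single_le_sum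
          (f := fun q' => ‖(U *ᵥ fun a => v (a, q, r)) (m, q')‖ ^ 2)
          (fun _ _ => by positivity) (Finset.mem_univ q)
    _ ≤ ∑ r, ∑ q, ∑ a, ‖v (a, q, r)‖ ^ 2 :=
        Finset.sum_le_sum fun r _ => Finset.sum_le_sum fun q _ => hU _
    _ = ∑ j, ‖v j‖ ^ 2 := by
        rw [Fintype.sum_prod_type_right, Fintype.sum_prod_type_right]

theorem teleportMat_mulVec_eq {M Q R A : Type*} [Fintype Q] [DecidableEq Q] [Fintype R]
    [DecidableEq R] [Fintype A] (U : Matrix (M × Q) A ℂ) {v : A × Q × R → ℂ} {g : A → ℂ}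
    {q₀ : Q} {r : R} (h : ∀ a q, v (a, q, r) = if q = q₀ then g a else 0) (m : M) :
    (teleportMat U *ᵥ v) (m, r) = ((√(Fintype.card Q))⁻¹ : ℝ) * (U *ᵥ g) (m, q₀) := by
  rw [teleportMat_mulVec, Finset.sum_eq_single q₀]
  · simp only [h, if_true]
  · intro q _ hq
    simp [h, hq, Matrix.mulVec, dotProduct]
  · simp

/-- The state shared after a simulated round: the server's operation `S` has been applied to the
previous state `ψ`, its messages `P`, `P'` have been handed over, and each register that is to be
transmitted by teleportation (`J`: Alice to server, `K`: Alice to Bob, `J'`: Bob to server,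
`K'`: Bob to Alice) is half of a maximally entangled pair. -/
def teleportState {A B N N' P P' J K J' K' : Type*} [Fintype N]
    [Fintype J] [Fintype K] [Fintype J'] [Fintype K']
    [DecidableEq J] [DecidableEq K] [DecidableEq J'] [DecidableEq K']
    (S : Matrix (N' × P × P') N ℂ) (ψ : A × B × N → ℂ) :
    (A × (J × K) × (P × K')) × (B × (J' × K') × (P' × K)) × (N' × J × J') → ℂ :=
  fun ((a, (j, k), (u, l')), (b, (j', k'), (u', l)), (n, i, i')) =>
    if (j', k') = (i', l') then if (j, k) = (i, l) then
      ((√(Fintype.card (J × K)))⁻¹ * (√(Fintype.card (J' × K')))⁻¹ : ℝ) *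
        (S *ᵥ fun c => ψ (a, b, c)) (n, u, u') else 0 else 0

theorem sum_ite_diagonal {Q Q' : Type*} [Fintype Q] [Fintype Q'] [DecidableEq Q] [DecidableEq Q']
    (x : ℝ) :
    ∑ z : Q × Q × Q' × Q', (if z.2.2.1 = z.2.2.2 then if z.1 = z.2.1 then x else 0 else 0) =
      Fintype.card Q * (Fintype.card Q' * x) := by
  calc _ = ∑ q : Q, ∑ q₀ : Q, ∑ q' : Q', ∑ q₀' : Q',
        (if q' = q₀' then if q = q₀ then x else 0 else 0) := by
        simp only [Fintype.sum_prod_type]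
    _ = _ := by simp

theorem sum_norm_sq_teleportState {A B N N' P P' J K J' K' : Type*} [Fintype A] [Fintype B]
    [Fintype N] [DecidableEq N] [Fintype N'] [Fintype P] [Fintype P'] [Fintype J] [Fintype K]
    [Fintype J'] [Fintype K'] [DecidableEq J] [DecidableEq K] [DecidableEq J'] [DecidableEq K']
    [Nonempty J] [Nonempty K] [Nonempty J']
    [Nonempty K'] {S : Matrix (N' × P × P') N ℂ}
    (hS : Sᴴ * S = 1) (ψ : A × B × N → ℂ) :
    ∑ i, ‖teleportState (J := J) (K := K) (J' := J') (K' := K') S ψ i‖ ^ 2 = ∑ i, ‖ψ i‖ ^ 2 := by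
  -- Each equality between the halves of a maximally entangled pair is turned into a diagonal sum.
  let e : (A × B × N' × P × P') × (J × K) × (J × K) × (J' × K') × (J' × K') ≃
      (A × (J × K) × (P × K')) × (B × (J' × K') × (P' × K)) × (N' × J × J') :=
    { toFun := fun ((a, b, n, u, u'), q, (i, l), q', (i', l')) =>
        ((a, q, (u, l')), (b, q', (u', l)), (n, i, i'))
      invFun := fun ((a, q, (u, l')), (b, q', (u', l)), (n, i, i')) =>
        ((a, b, n, u, u'), q, (i, l), q', (i', l'))
      left_inv := fun _ => rfl
      right_inv := fun _ => rfl }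
  let G : A × B × N' × P × P' → ℝ := fun w => ‖(S *ᵥ fun c => ψ (w.1, w.2.1, c)) w.2.2‖ ^ 2
  have he : ∀ z, ‖teleportState (J := J) (K := K) (J' := J') (K' := K') S ψ (e z)‖ ^ 2 =
      if z.2.2.2.1 = z.2.2.2.2 then if z.2.1 = z.2.2.1 then
        (Fintype.card (J' × K') : ℝ)⁻¹ * ((Fintype.card (J × K) : ℝ)⁻¹ * G z.1) else 0 else 0 := by
    rintro ⟨⟨a, b, n, u, u'⟩, ⟨j, k⟩, ⟨i, l⟩, ⟨j', k'⟩, ⟨i', l'⟩⟩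
    simp only [e, G, Equiv.coe_fn_mk, teleportState]
    split_ifs <;> simp [mul_pow]; ring
  have hc : (Fintype.card (J × K) : ℝ) ≠ 0 := by positivity
  have hc' : (Fintype.card (J' × K') : ℝ) ≠ 0 := by positivity
  have h : ∀ a b, ∑ i, ‖(S *ᵥ fun c => ψ (a, b, c)) i‖ ^ 2 = ∑ c, ‖ψ (a, b, c)‖ ^ 2 :=
    fun a b => sum_norm_sq_mulVec_of_isometry hS _
  have hG : ∑ i, ‖teleportState (J := J) (K := K) (J' := J') (K' := K') S ψ i‖ ^ 2 =
      ∑ w, G w := by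
    rw [← e.sum_comp, Fintype.sum_prod_type]
    refine Finset.sum_congr rfl fun w _ => ?_
    simp only [he]
    rw [sum_ite_diagonal, mul_inv_cancel_left₀ hc', mul_inv_cancel_left₀ hc]
  rw [hG]
  rw [Fintype.sum_prod_type, Fintype.sum_prod_type]
  refine Finset.sum_congr rfl fun a _ => ?_
  rw [Fintype.sum_prod_type, Fintype.sum_prod_type]
  exact Finset.sum_congr rfl fun b _ => h a b

/-- Up to a factor, the outcome of the postselected round is the result of the three local
operations, with the messages handed to their recipients. -/
theorem teleport_mulVec_teleportState {A B M M' N N' P P' J K J' K' : Type*} [Fintype A]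
    [Fintype B] [Fintype N] [Fintype N'] [DecidableEq N'] [Fintype P] [DecidableEq P]
    [Fintype P'] [DecidableEq P'] [Fintype J] [DecidableEq J] [Fintype K] [DecidableEq K]
    [Fintype J'] [DecidableEq J'] [Fintype K'] [DecidableEq K'] (U : Matrix (M × J × K) A ℂ)
    (U' : Matrix (M' × J' × K') B ℂ) (S : Matrix (N' × P × P') N ℂ) (ψ : A × B × N → ℂ)
    (m : M) (u : P) (k' : K') (m' : M') (u' : P') (k : K) (n : N') (j : J) (j' : J') :
    ((teleportMat U ⊗ₖ (teleportMat U' ⊗ₖ (1 : Matrix (N' × J × J') (N' × J × J') ℂ))) *ᵥ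
        teleportState S ψ) ((m, u, k'), (m', u', k), (n, j, j')) =
      ((Fintype.card (J × K) * Fintype.card (J' × K') : ℝ)⁻¹ : ℝ) *
        ((U ⊗ₖ (U' ⊗ₖ S)) *ᵥ ψ) ((m, j, k), (m', j', k'), (n, u, u')) := by
  have h1 : ∀ v : (A × (J × K) × (P × K')) × (B × (J' × K') × (P' × K)) × (N' × J × J') → ℂ,
    ((teleportMat U ⊗ₖ (teleportMat U' ⊗ₖ (1 : Matrix (N' × J × J') (N' × J × J') ℂ))) *ᵥ v)
      ((m, u, k'), (m', u', k), (n, j, j')) =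
    (teleportMat U *ᵥ fun a => (teleportMat U' *ᵥ fun b => v (a, b, (n, j, j'))) (m', u', k))
      (m, u, k') := by
    intro v
    rw [kronecker_kronecker_mulVec]
    simp only [Matrix.mulVec, dotProduct, Matrix.one_apply, ite_mul, one_mul, zero_mul,
      Finset.sum_ite_eq, Finset.mem_univ, if_true]
  let c : ℝ := (√(Fintype.card (J × K)))⁻¹ * (√(Fintype.card (J' × K')))⁻¹
  have h2 : ∀ a q, (teleportMat U' *ᵥ fun b => teleportState S ψ
      ((a, q, (u, k')), b, (n, j, j'))) (m', u', k) = if q = (j, k) then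
        ((√(Fintype.card (J' × K')))⁻¹ : ℝ) *
          (U' *ᵥ fun b => c * (S *ᵥ fun c => ψ (a, b, c)) (n, u, u')) (m', j', k') else 0 := by
    intro a q
    split_ifs with hq
    · exact teleportMat_mulVec_eq U' (fun b q' => by simp [teleportState, hq, c]) m'
    · obtain ⟨j₁, k₁⟩ := q
      rw [teleportMat_mulVec]
      simp [teleportState, hq, Matrix.mulVec, dotProduct]
  rw [h1, teleportMat_mulVec_eq U h2, kronecker_kronecker_mulVec]
  simp only [Matrix.mulVec, dotProduct]
  have hc : (√(Fintype.card (J × K)) : ℝ)⁻¹ * (√(Fintype.card (J × K)) : ℝ)⁻¹ =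
      (Fintype.card (J × K) : ℝ)⁻¹ := by
    rw [← mul_inv, Real.mul_self_sqrt (Nat.cast_nonneg _)]
  have hc' : (√(Fintype.card (J' × K')) : ℝ)⁻¹ * (√(Fintype.card (J' × K')) : ℝ)⁻¹ =
      (Fintype.card (J' × K') : ℝ)⁻¹ := by
    rw [← mul_inv, Real.mul_self_sqrt (Nat.cast_nonneg _)]
  rw [mul_inv, ← hc, ← hc']
  simp only [Finset.mul_sum, c]
  push_cast
  refine Finset.sum_congr rfl fun a _ => Finset.sum_congr rfl fun b _ =>
    Finset.sum_congr rfl fun d _ => by ring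

/-! ### Postselected simulation of a protocol -/

namespace ServerProtocol

variable {X Y : Type*} {T : ℕ} (p : ServerProtocol X Y T)

/-- A shared state of two players and of the passive server, together with local contractions that
turn it into a multiple, with factor `α`, of the state of the protocol `p` at time `t`. In other
words, the players succeed with probability `α ^ 2` in preparing that state without
communication. -/
structure PostselectedSimulation (t : ℕ) where
  A : Type
  B : Type
  [fintypeA : Fintype A]
  [fintypeB : Fintype B]
  ψ : A × B × p.ServerReg t → ℂ
  ψ_unit : ∑ i, ‖ψ i‖ ^ 2 = 1
  W : X → Matrix (p.CarolReg t) A ℂ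
  V : Y → Matrix (p.DavidReg t) B ℂ
  W_contraction : ∀ x, IsContraction (W x)
  V_contraction : ∀ y, IsContraction (V y)
  α : ℝ
  le_α : (1 / 4) ^ t ≤ α
  mulVec_ψ : ∀ x y, (W x ⊗ₖ (V y ⊗ₖ (1 : Matrix (p.ServerReg t) (p.ServerReg t) ℂ))) *ᵥ ψ =
    α • p.state x y t

attribute [instance] PostselectedSimulation.fintypeA PostselectedSimulation.fintypeB

/-- Nothing has to be simulated at time `0`: the players hold the initial state. -/
def PostselectedSimulation.zero : p.PostselectedSimulation 0 where
  A := p.CarolReg 0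
  B := p.DavidReg 0
  ψ := p.init
  ψ_unit := p.init_unit
  W _ := 1
  V _ := 1
  W_contraction _ := .of_isometry (by simp)
  V_contraction _ := .of_isometry (by simp)
  α := 1
  le_α := by simp
  mulVec_ψ x y := by simp [state]

/-- The two players together send at most two qubits in a round. -/
theorem card_sent_le {a b c d : ℕ} (h : a + b ≤ 1) (h' : c + d ≤ 1) :
    ((1 : ℝ) / 4) ≤ ((Fintype.card (Fin (2 ^ b) × Fin (2 ^ a)) *
      Fintype.card (Fin (2 ^ d) × Fin (2 ^ c)) : ℝ))⁻¹ := by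
  have h1 : (2 : ℝ) ^ (a + b) ≤ 2 ^ 1 := pow_le_pow_right₀ (by norm_num) h
  have h2 : (2 : ℝ) ^ (c + d) ≤ 2 ^ 1 := pow_le_pow_right₀ (by norm_num) h'
  rw [one_div]
  simp only [Fintype.card_prod, Fintype.card_fin]
  push_cast
  rw [← pow_add, ← pow_add, add_comm b, add_comm d]
  gcongr
  nlinarith [pow_pos (zero_lt_two' ℝ) (a + b), pow_pos (zero_lt_two' ℝ) (c + d)]

variable {p} in
/-- The messages of one further round are simulated: those of the server belong to the shared
state, the qubits sent by the players are teleported, with postselection on the outcome that needs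
no correction. -/
def PostselectedSimulation.succ {t : ℕ} (s : p.PostselectedSimulation t) :
    p.PostselectedSimulation (t + 1) where
  A := s.A × (Fin (2 ^ p.cs (t + 1)) × Fin (2 ^ p.cd (t + 1))) ×
    (Fin (p.sc (t + 1)) × Fin (2 ^ p.dc (t + 1)))
  B := s.B × (Fin (2 ^ p.ds (t + 1)) × Fin (2 ^ p.dc (t + 1))) ×
    (Fin (p.sd (t + 1)) × Fin (2 ^ p.cd (t + 1)))
  ψ := teleportState (p.serverOp t) s.ψ
  ψ_unit := by rw [sum_norm_sq_teleportState (p.server_isometry t), s.ψ_unit]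
  W x := teleportMat (p.carolOp t x * s.W x)
  V y := teleportMat (p.davidOp t y * s.V y)
  W_contraction x := ((IsContraction.of_isometry (p.carol_isometry t x)).mul
    (s.W_contraction x)).teleportMat
  V_contraction y := ((IsContraction.of_isometry (p.david_isometry t y)).mul
    (s.V_contraction y)).teleportMat
  α := (Fintype.card (Fin (2 ^ p.cs (t + 1)) × Fin (2 ^ p.cd (t + 1))) *
    Fintype.card (Fin (2 ^ p.ds (t + 1)) × Fin (2 ^ p.dc (t + 1))) : ℝ)⁻¹ * s.α
  le_α := by
    rw [pow_succ']
    exact mul_le_mul (card_sent_le (p.carol_le_one t) (p.david_le_one t)) s.le_α (by positivity)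
      (by positivity)
  mulVec_ψ x y := by
    funext ⟨⟨memC, fromS, fromD⟩, ⟨memD, fromS', fromC⟩, ⟨memS, fromC', fromD'⟩⟩
    refine (teleport_mulVec_teleportState _ _ _ _ memC fromS fromD memD fromS' fromC memS
      fromC' fromD').trans ?_
    have h : (p.carolOp t x * s.W x) ⊗ₖ ((p.davidOp t y * s.V y) ⊗ₖ p.serverOp t) =
        (p.carolOp t x ⊗ₖ (p.davidOp t y ⊗ₖ p.serverOp t)) *
          (s.W x ⊗ₖ (s.V y ⊗ₖ (1 : Matrix (p.ServerReg t) (p.ServerReg t) ℂ))) := by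
      rw [← Matrix.mul_kronecker_mul, ← Matrix.mul_kronecker_mul, Matrix.mul_one]
    rw [h, ← Matrix.mulVec_mulVec, s.mulVec_ψ, Matrix.mulVec_smul]
    simp only [Pi.smul_apply, state, Complex.real_smul]
    push_cast
    ring

/-- A postselected simulation of the first `t` rounds. -/
def postselectedSimulation : ∀ t, p.PostselectedSimulation t
  | 0 => .zero p
  | t + 1 => (postselectedSimulation t).succ

/-- Handing the messages to their recipients permutes the basis of the global register. -/
def deliverEquiv (α α' α'' δ δ' δ'' σ σ' σ'' : Type*) :
    (α × σ' × δ'') × (δ × σ'' × α'') × (σ × α' × δ') ≃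
      (α × α' × α'') × (δ × δ' × δ'') × (σ × σ' × σ'') where
  toFun := fun ((a, e', b''), (b, e'', a''), (e, a', b')) =>
    ((a, a', a''), (b, b', b''), (e, e', e''))
  invFun := fun ((a, a', a''), (b, b', b''), (e, e', e'')) =>
    ((a, e', b''), (b, e'', a''), (e, a', b'))
  left_inv _ := rfl
  right_inv _ := rfl

theorem state_unit (x : X) (y : Y) : ∀ t, ∑ i, ‖p.state x y t i‖ ^ 2 = 1
  | 0 => p.init_unit
  | t + 1 => by
    have hU : (p.carolOp t x ⊗ₖ (p.davidOp t y ⊗ₖ p.serverOp t))ᴴ *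
        (p.carolOp t x ⊗ₖ (p.davidOp t y ⊗ₖ p.serverOp t)) = 1 := by
      simp only [Matrix.conjTranspose_kronecker, ← Matrix.mul_kronecker_mul, p.carol_isometry,
        p.david_isometry, p.server_isometry, Matrix.one_kronecker_one]
    rw [← state_unit x y t, ← sum_norm_sq_mulVec_of_isometry hU]
    exact (deliverEquiv _ _ _ _ _ _ _ _ _).sum_comp
      fun i => ‖((p.carolOp t x ⊗ₖ (p.davidOp t y ⊗ₖ p.serverOp t)) *ᵥ p.state x y t) i‖ ^ 2

theorem carolProb_nonneg (x : X) (y : Y) (b : Bool) : 0 ≤ p.carolProb x y b := by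
  have h : IsBinaryMeasurement fun b =>
      p.carolMeas x b ⊗ₖ (1 : Matrix (p.DavidReg T × p.ServerReg T) _ ℂ) :=
    { isHermitian := fun b => by
        rw [Matrix.IsHermitian, Matrix.conjTranspose_kronecker,
          ((p.carolMeas_isMeas x).isHermitian b).eq, Matrix.conjTranspose_one]
      idempotent := fun b => by
        rw [← Matrix.mul_kronecker_mul, (p.carolMeas_isMeas x).idempotent, Matrix.mul_one]
      complete := by
        rw [← Matrix.add_kronecker, (p.carolMeas_isMeas x).complete, Matrix.one_kronecker_one] }
  exact h.bornProb_nonneg b _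

theorem carolProb_add (x : X) (y : Y) : p.carolProb x y false + p.carolProb x y true = 1 := by
  rw [carolProb, carolProb, ← bornProb_add, ← Matrix.add_kronecker,
    (p.carolMeas_isMeas x).complete, Matrix.one_kronecker_one, bornProb_one, p.state_unit]

/-- There are a shared state and local contractions that prepare the final state of the protocol
with amplitude exactly `4 ^ (-T)`. The second player holds the server's register. The conclusion is
expressed by the joint probability that the first player succeeds and then obtains Carol's outcome
`b`, while the second player succeeds. -/
theorem exists_contractions_bornProb_eq : ∃ (A B : Type) (_ : Fintype A) (_ : Fintype B)
    (ψ : A × B → ℂ) (W : X → Matrix (p.CarolReg T) A ℂ)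
    (V : Y → Matrix (p.DavidReg T × p.ServerReg T) B ℂ),
    ∑ i, ‖ψ i‖ ^ 2 = 1 ∧ (∀ x, IsContraction (W x)) ∧ (∀ y, IsContraction (V y)) ∧
    ∀ x y b, bornProb (((W x)ᴴ * p.carolMeas x b * W x) ⊗ₖ ((V y)ᴴ * V y)) ψ =
      (4 : ℝ) ^ (-2 * (T : ℤ)) * p.carolProb x y b := by
  obtain ⟨s⟩ : Nonempty (p.PostselectedSimulation T) := ⟨p.postselectedSimulation T⟩
  have hα : 0 < s.α := lt_of_lt_of_le (by positivity) s.le_α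
  -- Rescaling makes up for rounds in which fewer than two qubits are sent.
  have hβ : (1 / 4) ^ T / s.α ≤ 1 := (div_le_one hα).mpr s.le_α
  refine ⟨s.A, s.B × p.ServerReg T, inferInstance, inferInstance, s.ψ,
    fun x => ((1 / 4) ^ T / s.α) • s.W x, fun y => s.V y ⊗ₖ 1, s.ψ_unit,
    fun x => (s.W_contraction x).smul (by positivity) hβ,
    fun y => (s.V_contraction y).kronecker_one, fun x y b => ?_⟩
  have h : ((((1 / 4) ^ T / s.α) • s.W x) ⊗ₖ
      (s.V y ⊗ₖ (1 : Matrix (p.ServerReg T) (p.ServerReg T) ℂ))) *ᵥ s.ψ =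
        ((1 / 4 : ℝ) ^ T) • p.state x y T := by
    rw [Matrix.smul_kronecker, Matrix.smul_mulVec, s.mulVec_ψ, smul_smul, div_mul_cancel₀ _ hα.ne']
  rw [← Matrix.mul_one ((s.V y ⊗ₖ (1 : Matrix (p.ServerReg T) (p.ServerReg T) ℂ))ᴴ),
    Matrix.mul_kronecker_mul, Matrix.mul_kronecker_mul, ← Matrix.conjTranspose_kronecker,
    bornProb_conj, h, bornProb_smul_right, carolProb]
  congr 1
  rw [← pow_mul, mul_comm T 2, one_div, inv_pow, ← zpow_natCast, ← zpow_neg]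
  push_cast
  rw [neg_mul]

/-! ### The strategies for the two games -/

open scoped ComplexOrder in
/-- Alice answers `1` if she succeeds and Carol's outcome is `1`, Bob answers `1` if he succeeds. -/
theorem exists_strategy_and : ∃ S : EntangledStrategy X Y, ∀ x y o,
    S.outputProb and x y o = (4 : ℝ) ^ (-2 * (T : ℤ)) * p.carolProb x y o +
      (1 - (4 : ℝ) ^ (-2 * (T : ℤ))) * (if o = false then 1 else 0) := by
  classical
  obtain ⟨A, B, _, _, ψ, W, V, hψ, hW, hV, hprob⟩ := p.exists_contractions_bornProb_eq
  obtain ⟨S, hS⟩ := exists_entangledStrategy_prob_eq ψ hψ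
    (fun x => (W x)ᴴ * p.carolMeas x true * W x) (fun y => (V y)ᴴ * V y)
    (fun x => ((p.carolMeas_isMeas x).posSemidef true).conjTranspose_mul_mul_same _)
    (fun x => by
      have h : 1 - (W x)ᴴ * p.carolMeas x true * W x =
          1 - (W x)ᴴ * W x + (W x)ᴴ * p.carolMeas x false * W x := by
        rw [(p.carolMeas_isMeas x).conj_add (W x)]
        abel
      rw [h]
      exact (hW x).posSemidef.add
        (((p.carolMeas_isMeas x).posSemidef false).conjTranspose_mul_mul_same _))
    (fun y => Matrix.posSemidef_conjTranspose_mul_self _) (fun y => (hV y).posSemidef)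
  refine ⟨S, fun x y o => ?_⟩
  have h1 : S.prob x y true true = (4 : ℝ) ^ (-2 * (T : ℤ)) * p.carolProb x y true := by
    rw [hS, ← hprob]
    rfl
  have hsum := S.sum_prob x y
  have hc := p.carolProb_add x y
  cases o
  · simp [EntangledStrategy.outputProb] at hsum h1 ⊢
    rw [← eq_sub_iff_add_eq] at hc
    rw [hc]
    linarith
  · simp [EntangledStrategy.outputProb] at h1 ⊢
    exact h1

open scoped ComplexOrder in
/-- A player who does not succeed answers a random bit. Otherwise Alice answers Carol's outcome and
Bob answers `0`. -/
theorem exists_strategy_xor : ∃ S : EntangledStrategy X Y, ∀ x y o,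
    S.outputProb xor x y o = (4 : ℝ) ^ (-2 * (T : ℤ)) * p.carolProb x y o +
      (1 - (4 : ℝ) ^ (-2 * (T : ℤ))) * (1 / 2) := by
  classical
  obtain ⟨A, B, _, _, ψ, W, V, hψ, hW, hV, hprob⟩ := p.exists_contractions_bornProb_eq
  set E : X → Bool → Matrix A A ℂ := fun x b => (W x)ᴴ * p.carolMeas x b * W x
  set G : Y → Matrix B B ℂ := fun y => (V y)ᴴ * V y
  have hadd : ∀ x, (W x)ᴴ * W x = E x false + E x true :=
    fun x => (p.carolMeas_isMeas x).conj_add (W x)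
  have hEpos : ∀ x b, (E x b).PosSemidef := fun x b =>
    ((p.carolMeas_isMeas x).posSemidef b).conjTranspose_mul_mul_same _
  have hWpos : ∀ x, (1 - (E x false + E x true)).PosSemidef := fun x => hadd x ▸ (hW x).posSemidef
  have hhalf : (0 : ℝ) ≤ 1 / 2 := by norm_num
  -- The effect of each player for the answer `1` is half of that of the failure, plus, for Alice,
  -- that of Carol's outcome `1`. The complements have the corresponding form.
  have hcompl : ∀ x, 1 - ((1 / 2 : ℝ) • (1 - (E x false + E x true)) + E x true) =
      (1 / 2 : ℝ) • (1 - (E x false + E x true)) + E x false := fun x => by module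
  have hcompl' : ∀ y, 1 - (1 / 2 : ℝ) • (1 - G y) = (1 / 2 : ℝ) • (1 - G y) + G y :=
    fun y => by module
  obtain ⟨S, hS⟩ := exists_entangledStrategy_prob_eq ψ hψ
    (fun x => (1 / 2 : ℝ) • (1 - (E x false + E x true)) + E x true)
    (fun y => (1 / 2 : ℝ) • (1 - G y))
    (fun x => ((hWpos x).smul hhalf).add (hEpos x true))
    (fun x => hcompl x ▸ ((hWpos x).smul hhalf).add (hEpos x false))
    (fun y => (hV y).posSemidef.smul hhalf)
    (fun y => hcompl' y ▸ ((hV y).posSemidef.smul hhalf).add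
      (Matrix.posSemidef_conjTranspose_mul_self _))
  refine ⟨S, fun x y o => ?_⟩
  have hfalse : S.outputProb xor x y false = S.prob x y false false + S.prob x y true true := by
    simp [EntangledStrategy.outputProb]; ring
  -- The bias of the answer is the bias of Carol's outcome, weighted by both players' success.
  have hbias : S.outputProb xor x y false =
      1 / 2 + (4 : ℝ) ^ (-2 * (T : ℤ)) * (p.carolProb x y false - p.carolProb x y true) / 2 := by
    have hkron : effectPair ((1 / 2 : ℝ) • (1 - (E x false + E x true)) + E x true) false ⊗ₖ
          effectPair ((1 / 2 : ℝ) • (1 - G y)) false +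
        effectPair ((1 / 2 : ℝ) • (1 - (E x false + E x true)) + E x true) true ⊗ₖ
          effectPair ((1 / 2 : ℝ) • (1 - G y)) true =
        (1 / 2 : ℝ) • (1 + (E x false ⊗ₖ G y - E x true ⊗ₖ G y)) := by
      simp only [effectPair, Bool.false_eq_true, if_false, if_true]
      ext ⟨a, b⟩ ⟨a', b'⟩
      rw [← Matrix.one_kronecker_one]
      simp only [Matrix.add_apply, Matrix.sub_apply, Matrix.smul_apply, Matrix.kroneckerMap_apply,
        Complex.real_smul]
      push_cast
      ring
    rw [hfalse, hS, hS, ← bornProb_add, hkron, bornProb_smul, bornProb_add, bornProb_sub, hprob,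
      hprob, bornProb_one, hψ]
    ring
  have hc : p.carolProb x y true = 1 - p.carolProb x y false :=
    eq_sub_of_add_eq' (p.carolProb_add x y)
  cases o
  · rw [hbias, hc]
    ring
  · have htrue : S.outputProb xor x y true = 1 - S.outputProb xor x y false := by
      rw [hfalse, ← S.sum_prob x y]
      simp [EntangledStrategy.outputProb]
      ring
    rw [htrue, hbias, hc]
    ring

end ServerProtocol

end

theorem mainTheorem8 {X Y : Type*} [Finite X] [Finite Y] (f : X → Y → Bool) (ε₀ ε₁ : ℝ)
    (hε₀ : 0 ≤ ε₀) (hε₁ : 0 ≤ ε₁) :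
    (∃ S : EntangledStrategy X Y,
      SimulatesWithProb S xor f ε₀ ε₁ ((4 : ℝ) ^ (-2 * (serverComplexity f ε₀ ε₁ : ℤ)))
        (fun _ => 1 / 2)) ∧
    (∃ S : EntangledStrategy X Y,
      SimulatesWithProb S and f ε₀ ε₁ ((4 : ℝ) ^ (-2 * (serverComplexity f ε₀ ε₁ : ℤ)))
        (fun o => if o = false then 1 else 0)) := by
  obtain ⟨p, hp⟩ : ∃ p : ServerProtocol X Y (serverComplexity f ε₀ ε₁), p.Computes f ε₀ ε₁ :=
    Nat.sInf_mem (exists_serverProtocol_computes f hε₀ hε₁)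
  constructor
  · obtain ⟨S, hS⟩ := p.exists_strategy_xor
    exact ⟨S, fun x y => ⟨p.carolProb x y, p.carolProb_nonneg x y, p.carolProb_add x y,
      (hp x y).1, hS x y⟩⟩
  · obtain ⟨S, hS⟩ := p.exists_strategy_and
    exact ⟨S, fun x y => ⟨p.carolProb x y, p.carolProb_nonneg x y, p.carolProb_add x y,
      (hp x y).1, hS x y⟩⟩
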